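/- Let $C$ be a smooth projective geometrically irreducible curve over the finite field $\mathbb{F}_q$ with $q$ elements, let $\infty\in C(\mathbb{F}_q)$ be a rational point, and let $A=\Gamma(C\smallsetminus\{\infty\},\mathcal{O}_C)$. Let $L\supseteq\mathbb{F}_q$ be an arbitrary field, let $c^*:A\to L$ be an $\mathbb{F}_q$-homomorphism, put $A_L=A\otimes_{\mathbb{F}_q}L$, $C_L=C\times_{\mathbb{F}_q}L$, $J=(a\otimes 1-1\otimes c^*(a):a\in A)\subseteq A_L$, and let $\sigma=\mathrm{id}_C\times\mathrm{Spec}(\mathrm{Frob}_q)$ be the endomorphism of $C_L$ that is the $q$-Frobenius on $L$, so that $\sigma^*(a\otimes b)=a\otimes b^q$ on $A_L$; for an $A_L$-module $M$ put $\sigma^*M=M\otimes_{A_L,\sigma^*}A_L$. A pure Anderson motive $\underline{M}=(M,\tau)$ of rank $r$, dimension $d$ and characteristic $c^*$ over $L$ (with integers $r,d\ge 0$) consists of a locally free $A_L$-module $M$ of rank $r$ and an injective $A_L$-homomorphism $\tau:\sigma^*M\to M$ such that 1. $\operatorname{coker}\tau$ is an $L$-vector space of dimension $d$ and is annihilated by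 $J^d$, and 2. $M$ extends to a locally free sheaf $\mathcal{M}$ of rank $r$ on $C_L$ such that, for some positive integers $k,l$, the map $\tau^l=\tau\circ\sigma^*(\tau)\circ\dots\circ(\sigma^*)^{l-1}(\tau):(\sigma^*)^lM\to M$ induces an isomorphism $(\sigma^*)^l\mathcal{M}_\infty\to\mathcal{M}(k\cdot\infty)_\infty$ of the stalks at $\infty$. For pure Anderson motives $\underline{M}=(M,\tau)$ and $\underline{M}'=(M',\tau')$ of the same characteristic $c^*$, let $\operatorname{Hom}(\underline{M},\underline{M}')$ be the set of $A_L$-homomorphisms $f:M\to M'$ with $f\circ\tau=\tau'\circ\sigma^*(f)$; it is an $A$-module via $(a\cdot f)(m)=(a\otimes 1)f(m)$. **Theorem.** Let $\underline{M}$ and $\underline{M}'$ be pure Anderson motives of ranks $r$ and $r'$ (and arbitrary dimensions $d$ and $d'$) and of the same characteristic $c^*$ over an arbitrary field $L\supseteq\mathbb{F}_q$. Then $\operatorname{Hom}(\underline{M},\underline{M}')$ is a finitely generated projective $A$-module of rank $\le rr'$. -/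

import Mathlib

open CategoryTheory CategoryTheory.Limits AlgebraicGeometry TopologicalSpace TensorProduct

universe u

noncomputable section

/-- A smooth proper geometrically irreducible curve `C` over `Fq` together with an `Fq`-rational
point `∞ ∈ C(Fq)`. (A proper curve over a field is automatically projective.) -/
structure PointedCurve (Fq : Type u) [Field Fq] where
  /-- The curve. -/
  C : Scheme.{u}
  /-- The structure morphism. -/
  str : C ⟶ Spec (CommRingCat.of Fq)
  proper : IsProper str
  smooth : SmoothOfRelativeDimension 1 str
  geomIrred : GeometricallyIrreducible str
  /-- The rational point `∞`, a section of the structure morphism. -/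
  inf : Spec (CommRingCat.of Fq) ⟶ C
  inf_str : inf ≫ str = 𝟙 _

namespace PointedCurve

variable {Fq : Type u} [Field Fq] (X : PointedCurve Fq)

theorem isClosed_range_inf : IsClosed (Set.range X.inf) := by
  have := X.proper
  have : IsClosedImmersion (X.inf ≫ X.str) := by
    rw [X.inf_str]; infer_instance
  have : IsClosedImmersion X.inf := IsClosedImmersion.of_comp X.inf X.str
  exact X.inf.isClosedEmbedding.isClosed_range

/-- The open subscheme `C' = C ∖ {∞}`. -/
def Caff : X.C.Opens := ⟨(Set.range X.inf)ᶜ, X.isClosed_range_inf.isOpen_compl⟩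

/-- The ring `A = Γ(C ∖ {∞}, 𝒪_C)`. -/
def A : Type u := Γ(X.C, X.Caff)

instance : CommRing X.A := inferInstanceAs (CommRing Γ(X.C, X.Caff))

/-- The structure map `Fq → A`. -/
def algMap : Fq →+* X.A :=
  ((Scheme.ΓSpecIso (CommRingCat.of Fq)).inv ≫ X.str.appTop ≫
    X.C.presheaf.map (homOfLE le_top).op).hom

instance : Algebra Fq X.A := X.algMap.toAlgebra

section BaseChange

variable (L : Type u) [Field L] [Algebra Fq L]

/-- The ring `A_L = A ⊗_{Fq} L`. -/
abbrev AL : Type u := X.A ⊗[Fq] L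

/-- The morphism `Spec L → Spec Fq`. -/
abbrev specL (Fq : Type u) [Field Fq] (L : Type u) [Field L] [Algebra Fq L] :
    Spec (CommRingCat.of L) ⟶ Spec (CommRingCat.of Fq) :=
  Spec.map (CommRingCat.ofHom (algebraMap Fq L))

/-- The curve `C_L = C ×_{Spec Fq} Spec L`. -/
def CL : Scheme.{u} := pullback X.str (specL Fq L)

/-- The projection `C_L → C`. -/
def toC : X.CL L ⟶ X.C := pullback.fst X.str (specL Fq L)

/-- The projection `C_L → Spec L`. -/
def toL : X.CL L ⟶ Spec (CommRingCat.of L) := pullback.snd X.str (specL Fq L)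

theorem condition : X.toC L ≫ X.str = X.toL L ≫ specL Fq L := pullback.condition

/-- The open subscheme `C'_L = C_L ∖ {∞}`, the preimage of `C'`. -/
def CaffL : (X.CL L).Opens := X.toC L ⁻¹ᵁ X.Caff

/-- The section `Spec L → C_L` given by `∞`. -/
def infL : Spec (CommRingCat.of L) ⟶ X.CL L :=
  pullback.lift (specL Fq L ≫ X.inf) (𝟙 _) (by
    rw [Category.assoc, X.inf_str, Category.comp_id, Category.id_comp])

/-- The point `∞` of `C_L`. -/
def ptInf : X.CL L := X.infL L (IsLocalRing.closedPoint L)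

/-- The map `A → Γ(C'_L, 𝒪)`. -/
def ofA : X.A →+* Γ(X.CL L, X.CaffL L) := ((X.toC L).app X.Caff).hom

/-- The map `L → Γ(C'_L, 𝒪)`. -/
def ofL : L →+* Γ(X.CL L, X.CaffL L) :=
  ((Scheme.ΓSpecIso (CommRingCat.of L)).inv ≫ (X.toL L).appTop ≫
    (X.CL L).presheaf.map (homOfLE le_top).op).hom

variable [Finite Fq]

/-- The `q`-Frobenius endomorphism `x ↦ x ^ q` of `L`. -/
def frob (Fq : Type u) [Field Fq] [Finite Fq] (L : Type u) [Field L] [Algebra Fq L] : L →ₐ[Fq] L :=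
  letI := Fintype.ofFinite Fq
  FiniteField.frobeniusAlgHom Fq L

/-- The endomorphism `σ^* : a ⊗ b ↦ a ⊗ b ^ q` of `A_L`. -/
def sig : X.AL L →ₐ[Fq] X.AL L := Algebra.TensorProduct.map (AlgHom.id Fq X.A) (frob Fq L)

theorem specL_frob :
    Spec.map (CommRingCat.ofHom (frob Fq L).toRingHom) ≫ specL Fq L = specL Fq L := by
  have h : (frob Fq L).toRingHom.comp (algebraMap Fq L) = algebraMap Fq L :=
    (frob Fq L).comp_algebraMap
  rw [specL, ← Spec.map_comp, ← CommRingCat.ofHom_comp, h]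

/-- The endomorphism `σ = id_C × Spec(Frob_q)` of `C_L`. -/
def sigC : X.CL L ⟶ X.CL L :=
  pullback.lift (X.toC L) (X.toL L ≫ Spec.map (CommRingCat.ofHom (frob Fq L).toRingHom)) (by
    rw [X.condition, Category.assoc, specL_frob])

theorem sigC_toC : X.sigC L ≫ X.toC L = X.toC L := pullback.lift_fst _ _ _

/-- The iterates of `σ : C_L → C_L`. -/
def sigCPow : ℕ → (X.CL L ⟶ X.CL L)
  | 0 => 𝟙 _
  | n + 1 => sigCPow n ≫ X.sigC L

theorem sigCPow_toC (n : ℕ) : X.sigCPow L n ≫ X.toC L = X.toC L := by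
  induction n with
  | zero => exact Category.id_comp _
  | succ n ih => rw [sigCPow, Category.assoc, sigC_toC, ih]

theorem sigCPow_preimage (n : ℕ) : X.sigCPow L n ⁻¹ᵁ X.CaffL L = X.CaffL L := by
  rw [CaffL, ← Scheme.Hom.comp_preimage, sigCPow_toC]

/-- The functor `M ↦ σ^* M = M ⊗_{A_L, σ^*} A_L` on `A_L`-modules. -/
abbrev pull : ModuleCat.{u} (X.AL L) ⥤ ModuleCat.{u} (X.AL L) :=
  ModuleCat.extendScalars (X.sig L).toRingHom

variable {X L}

/-- The map `M → σ^* M`, `m ↦ m ⊗ 1`. -/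
def pullMk {M : ModuleCat.{u} (X.AL L)} (m : M) : (X.pull L).obj M :=
  (ModuleCat.extendRestrictScalarsAdj (X.sig L).toRingHom).unit.app M m

/-- For `τ : σ^* M → M` the corresponding `σ^*`-semilinear map `M → M`, `m ↦ τ (m ⊗ 1)`. -/
def semi {M : ModuleCat.{u} (X.AL L)} (τ : (X.pull L).obj M ⟶ M) (m : M) : M :=
  τ (pullMk m)

theorem pullMk_add {M : ModuleCat.{u} (X.AL L)} (m n : M) :
    (pullMk (m + n) : (X.pull L).obj M) = pullMk m + pullMk n :=
  map_add ((ModuleCat.extendRestrictScalarsAdj (X.sig L).toRingHom).unit.app M).hom m n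

theorem pullMk_smul {M : ModuleCat.{u} (X.AL L)} (x : X.AL L) (m : M) :
    (pullMk (x • m) : (X.pull L).obj M) = X.sig L x • pullMk m :=
  map_smul ((ModuleCat.extendRestrictScalarsAdj (X.sig L).toRingHom).unit.app M).hom x m

theorem pull_map_pullMk {M N : ModuleCat.{u} (X.AL L)} (f : M ⟶ N) (m : M) :
    (X.pull L).map f (pullMk m) = pullMk (f m) := rfl

theorem pull_hom_ext {M N : ModuleCat.{u} (X.AL L)} {f g : (X.pull L).obj M ⟶ N}
    (h : ∀ m : M, f (pullMk m) = g (pullMk m)) : f = g :=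
  ModuleCat.ExtendScalars.hom_ext h

end BaseChange

end PointedCurve

/-- The sheaf of modules `𝓜` is locally free of rank `r`. -/
def IsLocallyFreeOfRank {Y : Scheme.{u}} (𝓜 : Y.Modules) (r : ℕ) : Prop :=
  ∀ y : Y, ∃ U : Y.Opens, y ∈ U ∧
    Nonempty (𝓜.restrict U.ι ≅
      (SheafOfModules.free (R := U.toScheme.ringCatSheaf) (ULift.{u} (Fin r)) : U.toScheme.Modules))

/-- The stalk `𝓜_y` is a module over the local ring `𝒪_{Y, y}`. -/
instance stalkModule {Y : Scheme.{u}} (𝓜 : Y.Modules) (y : Y) :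
    Module (Y.presheaf.stalk y) (𝓜.presheaf.stalk y) :=
  letI P : PresheafOfModules.{u} (Y.presheaf ⋙ forget₂ CommRingCat RingCat) := 𝓜.val
  inferInstanceAs (Module (Y.presheaf.stalk y) ↑(TopCat.Presheaf.stalk P.presheaf y))

/-- The map of stalks at `y` induced by a morphism of sheaves of modules. -/
def stalkMap {Y : Scheme.{u}} {𝓜 𝓝 : Y.Modules} (φ : 𝓜 ⟶ 𝓝) (y : Y) :
    𝓜.presheaf.stalk y →+ 𝓝.presheaf.stalk y :=
  ((TopCat.Presheaf.stalkFunctor Ab y).map φ.mapPresheaf).hom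

namespace PointedCurve

variable {Fq : Type u} [Field Fq] [Finite Fq] (X : PointedCurve Fq)
  (L : Type u) [Field L] [Algebra Fq L]

variable {X L} in
/-- The morphism `ι : 𝓜 → 𝓝` exhibits `𝓝` as `𝓜(k·∞)`: it is an isomorphism over `C'_L`,
and on stalks at `∞` it identifies `𝓜_∞` with `𝔪_∞ ^ k 𝓝_∞`. This determines `(𝓝, ι)` up to unique
isomorphism when `𝓜` and `𝓝` are locally free. -/
structure IsTwist (k : ℕ) {𝓜 𝓝 : (X.CL L).Modules} (ι : 𝓜 ⟶ 𝓝) : Prop where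
  bijective : ∀ U : (X.CL L).Opens, U ≤ X.CaffL L → Function.Bijective (ι.app U)
  injective : Function.Injective (stalkMap ι (X.ptInf L))
  range_eq : Set.range (stalkMap ι (X.ptInf L)) =
    ((IsLocalRing.maximalIdeal ((X.CL L).presheaf.stalk (X.ptInf L)) ^ k •
      (⊤ : Submodule ((X.CL L).presheaf.stalk (X.ptInf L))
        (𝓝.presheaf.stalk (X.ptInf L))) : Submodule _ _) : Set _)

variable {X L} in
/-- The purity condition on `τ : σ^* M → M`, for `M` of rank `r`: there are a locally free sheaf
`𝓜` of rank `r` on `C_L` extending `M` (via `e : M ≅ Γ(C'_L, 𝓜)`), and positive integers `k, l`, such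
that `τ ^ l : (σ^*) ^ l M → M` extends to a morphism `T : (σ^l)^* 𝓜 → 𝓜(k·∞)` which is an
isomorphism on stalks at `∞`.

The last conjunct says that `T` restricts to `τ ^ l` over `C'_L`; it is phrased through the morphism
`𝓜 → (σ^l)_* 𝓜(k·∞)` adjoint to `T` and the semilinear map `M → M` attached to `τ`, whose
`l`-th iterate is the semilinear map attached to `τ ^ l`. -/
def IsPure (r : ℕ) {M : ModuleCat.{u} (X.AL L)} (τ : (X.pull L).obj M ⟶ M) : Prop :=
  ∃ (𝓜 𝓝 : (X.CL L).Modules) (e : M ≃+ Γ(𝓜, X.CaffL L)) (k l : ℕ) (ι : 𝓜 ⟶ 𝓝)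
    (T : (Scheme.Modules.pullback (X.sigCPow L l)).obj 𝓜 ⟶ 𝓝),
    IsLocallyFreeOfRank 𝓜 r ∧ IsLocallyFreeOfRank 𝓝 r ∧
    (∀ (a : X.A) (b : L) (m : M), e ((a ⊗ₜ[Fq] b : X.AL L) • m) = (X.ofA L a * X.ofL L b) • e m) ∧
    0 < k ∧ 0 < l ∧ IsTwist k ι ∧
    Function.Bijective (stalkMap T (X.ptInf L)) ∧
    ∀ m : M,
      ((Scheme.Modules.pullbackPushforwardAdjunction (X.sigCPow L l)).homEquiv 𝓜 𝓝 T).app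
          (X.CaffL L) (e m) =
        𝓝.presheaf.map (homOfLE (X.sigCPow_preimage L l).le).op
          (ι.app (X.CaffL L) (e ((semi τ)^[l] m)))

end PointedCurve

/-- A pure Anderson motive of rank `r`, dimension `d` and characteristic `c : A → L` over `L`. -/
structure PureAndersonMotive {Fq : Type u} [Field Fq] [Finite Fq] (X : PointedCurve Fq)
    {L : Type u} [Field L] [Algebra Fq L] (c : X.A →ₐ[Fq] L) (r d : ℕ) where
  /-- The underlying `A_L`-module, locally free of rank `r`. -/
  M : ModuleCat.{u} (X.AL L)
  finite : Module.Finite (X.AL L) M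
  projective : Module.Projective (X.AL L) M
  rank_eq : ∀ p : PrimeSpectrum (X.AL L), Module.rankAtStalk (R := X.AL L) M p = r
  /-- The `A_L`-linear map `τ : σ^* M → M`. -/
  τ : (X.pull L).obj M ⟶ M
  injective : Function.Injective τ
  /-- The cokernel of `τ` has dimension `d` over `L`. -/
  rank_coker : Module.rank L ((ModuleCat.restrictScalars
    (Algebra.TensorProduct.includeRight : L →ₐ[Fq] X.AL L).toRingHom).obj
      (ModuleCat.of (X.AL L) (M ⧸ LinearMap.range τ.hom))) = d
  /-- The cokernel of `τ` is annihilated by `J ^ d`. -/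
  coker_annihilated : (Ideal.span (Set.range fun a : X.A =>
    (a ⊗ₜ[Fq] (1 : L) - (1 : X.A) ⊗ₜ[Fq] c a : X.AL L))) ^ d ≤
      Module.annihilator (X.AL L) (M ⧸ LinearMap.range τ.hom)
  pure : PointedCurve.IsPure r τ

namespace PureAndersonMotive

variable {Fq : Type u} [Field Fq] [Finite Fq] {X : PointedCurve Fq}
    {L : Type u} [Field L] [Algebra Fq L] {c : X.A →ₐ[Fq] L} {r d r' d' : ℕ}

theorem pull_map_add {M N : ModuleCat.{u} (X.AL L)} (f g : M ⟶ N) :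
    (X.pull L).map (f + g) = (X.pull L).map f + (X.pull L).map g :=
  PointedCurve.pull_hom_ext fun m => PointedCurve.pullMk_add (f m) (g m)

theorem pull_map_smul {M N : ModuleCat.{u} (X.AL L)} (a : X.A) (f : M ⟶ N) :
    (X.pull L).map ((a ⊗ₜ[Fq] (1 : L) : X.AL L) • f) =
      (a ⊗ₜ[Fq] (1 : L) : X.AL L) • (X.pull L).map f := by
  have h : X.sig L (a ⊗ₜ[Fq] (1 : L)) = a ⊗ₜ[Fq] (1 : L) := by
    rw [PointedCurve.sig, Algebra.TensorProduct.map_tmul, map_one, AlgHom.id_apply]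
  refine PointedCurve.pull_hom_ext fun m => ?_
  refine (PointedCurve.pullMk_smul (a ⊗ₜ[Fq] (1 : L)) (f m)).trans ?_
  rw [h]
  rfl

/-- The set `Hom(M, M')` of morphisms of pure Anderson motives: the homomorphisms `f : M → M'` of
`A_L`-modules such that `f ∘ τ = τ' ∘ σ^* f`. -/
def Hom (M : PureAndersonMotive X c r d) (M' : PureAndersonMotive X c r' d') :
    AddSubgroup (M.M ⟶ M'.M) :=
  AddMonoidHom.eqLocus (Preadditive.leftComp M'.M M.τ)
    ((Preadditive.rightComp _ M'.τ).comp (AddMonoidHom.mk' (X.pull L).map pull_map_add))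

theorem mem_Hom {M : PureAndersonMotive X c r d} {M' : PureAndersonMotive X c r' d'}
    {f : M.M ⟶ M'.M} : f ∈ Hom M M' ↔ M.τ ≫ f = (X.pull L).map f ≫ M'.τ := Iff.rfl

/-- `A` acts on `Hom(M, M')` by `(a • f)(m) = (a ⊗ 1) • f m`. -/
instance (M : PureAndersonMotive X c r d) (M' : PureAndersonMotive X c r' d') :
    Module X.A (Hom M M') where
  smul a f := ⟨(a ⊗ₜ[Fq] (1 : L) : X.AL L) • f.1, by
    rw [mem_Hom, pull_map_smul, Linear.comp_smul, Linear.smul_comp, mem_Hom.1 f.2]⟩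
  one_smul f := Subtype.ext (one_smul (X.AL L) f.1)
  mul_smul a b f := Subtype.ext (by
    change ((a * b) ⊗ₜ[Fq] (1 : L) : X.AL L) • f.1 =
      (a ⊗ₜ[Fq] (1 : L) : X.AL L) • (b ⊗ₜ[Fq] (1 : L) : X.AL L) • f.1
    rw [smul_smul, Algebra.TensorProduct.tmul_mul_tmul, one_mul])
  smul_zero a := Subtype.ext (smul_zero (a ⊗ₜ[Fq] (1 : L) : X.AL L))
  smul_add a f g := Subtype.ext (smul_add (a ⊗ₜ[Fq] (1 : L) : X.AL L) f.1 g.1)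
  add_smul a b f := Subtype.ext (by
    change ((a + b) ⊗ₜ[Fq] (1 : L) : X.AL L) • f.1 =
      (a ⊗ₜ[Fq] (1 : L) : X.AL L) • f.1 + (b ⊗ₜ[Fq] (1 : L) : X.AL L) • f.1
    rw [TensorProduct.add_tmul, add_smul])
  zero_smul f := Subtype.ext (by
    change ((0 : X.A) ⊗ₜ[Fq] (1 : L) : X.AL L) • f.1 = 0
    rw [TensorProduct.zero_tmul, zero_smul])

theorem coe_smul {M : PureAndersonMotive X c r d} {M' : PureAndersonMotive X c r' d'} (a : X.A)
    (f : Hom M M') : ((a • f : Hom M M') : M.M ⟶ M'.M) = (a ⊗ₜ[Fq] (1 : L) : X.AL L) • f.1 := rfl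

end PureAndersonMotive

end

noncomputable section

/-! Everything follows from the injectivity of A_L ⊗_A Hom(M, M') → Hom_{A_L}(M, M')
(`homBaseChange_injective`). The target is finitely generated over the noetherian ring A_L and
locally free of rank rr'. As A → A_L is faithfully flat, Hom(M, M') is finitely generated of rank at
most rr'; being torsion free over the Dedekind domain A, it is projective.

Injectivity is an Artin–Schreier descent (`sum_smul_eq_zero`). In a relation ∑ b_i f_i = 0 with b_i
∈ L independent over F_q, normalise one b_j to 1, apply τ', cancel τ and subtract. The coefficients
b_i^q − b_i with i ≠ j are again independent, and the relation is shorter.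

Cancelling τ is possible because its cokernel is killed by a power of a ⊗ 1 − 1 ⊗ c(a), a
nonzerodivisor when a is transcendental over F_q. If A = F_q, then τ is bijective by a dimension
count. `structure_A` derives this dichotomy, and the ring properties of A, from pole orders at ∞;
treating A = F_q separately avoids Riemann–Roch. -/

/-! ### Artin–Schreier independence over a finite field -/

theorem FiniteField.mem_range_algebraMap_of_pow_card_eq_self {F L : Type*} [Field F] [Fintype F]
    [Field L] [Algebra F L] {y : L} (hy : y ^ Fintype.card F = y) :
    y ∈ Set.range (algebraMap F L) := by
  classical
  have h1 : (Finset.univ.image (algebraMap F L)) =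
      (Polynomial.X ^ Fintype.card F - Polynomial.X : Polynomial L).roots.toFinset := by
    apply Finset.eq_of_subset_of_card_le
    · intro x hx
      obtain ⟨a, -, rfl⟩ := Finset.mem_image.1 hx
      rw [Multiset.mem_toFinset,
        Polynomial.mem_roots (FiniteField.X_pow_card_sub_X_ne_zero L Fintype.one_lt_card)]
      simp [← map_pow, FiniteField.pow_card]
    · rw [Finset.card_image_of_injective _ (algebraMap F L).injective, Finset.card_univ]
      refine (Multiset.toFinset_card_le _).trans ((Polynomial.card_roots' _).trans ?_)
      rw [FiniteField.X_pow_card_sub_X_natDegree_eq L Fintype.one_lt_card]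
  have h2 : y ∈ Finset.univ.image (algebraMap F L) := by
    rw [h1, Multiset.mem_toFinset,
      Polynomial.mem_roots (FiniteField.X_pow_card_sub_X_ne_zero L Fintype.one_lt_card)]
    simp [hy]
  simpa using h2

/-- Artin-Schreier images of a linearly independent family containing `1` are linearly independent
after `1` is removed. -/
theorem LinearIndepOn.pow_card_sub {F L ι : Type*} [Field F] [Fintype F] [Field L] [Algebra F L]
    {s : Finset ι} {j : ι} (hj : j ∉ s) {b : ι → L} (hbj : b j = 1)
    (hb : LinearIndepOn F b (insert j s : Set ι)) :
    LinearIndepOn F (fun i => b i ^ Fintype.card F - b i) (s : Set ι) := by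
  classical
  rw [linearIndepOn_finset_iff]
  intro f hf
  set y := ∑ i ∈ s, f i • b i with hy
  have hF : y ^ Fintype.card F = ∑ i ∈ s, f i • b i ^ Fintype.card F := by
    have := map_sum (FiniteField.frobeniusAlgHom F L) (fun i => f i • b i) s
    simpa [map_smul, ← hy] using this
  -- The relation says that y is fixed by Frobenius, so y lies in F = F · b j, which contradicts
  -- independence unless f vanishes on s.
  have hy' : y ^ Fintype.card F = y := by
    rw [← sub_eq_zero, hF, hy, ← Finset.sum_sub_distrib, ← hf]
    simp_rw [smul_sub]
  obtain ⟨a, ha⟩ := FiniteField.mem_range_algebraMap_of_pow_card_eq_self hy'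
  rw [← Finset.coe_insert, linearIndepOn_finset_iff] at hb
  have := hb (Function.update f j (-a)) (by
    rw [Finset.sum_insert hj, Function.update_self, hbj, neg_smul, ← Algebra.algebraMap_eq_smul_one,
      ha, hy, neg_add_eq_zero]
    refine Finset.sum_congr rfl fun i hi => ?_
    rw [Function.update_of_ne (fun h => hj (by rwa [← h]))])
  intro i hi
  have h := this i (Finset.mem_insert_of_mem hi)
  rwa [Function.update_of_ne (fun h => hj (by rwa [← h]))] at h

/-! ### Semilinear maps and independence of morphisms over A_L -/

namespace PointedCurve

variable {Fq : Type u} [Field Fq] [Finite Fq] {X : PointedCurve Fq}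
  {L : Type u} [Field L] [Algebra Fq L]

theorem semi_add {M : ModuleCat.{u} (X.AL L)} (τ : (X.pull L).obj M ⟶ M) (m n : M) :
    semi τ (m + n) = semi τ m + semi τ n := by
  rw [semi, pullMk_add, map_add]; rfl

theorem semi_smul {M : ModuleCat.{u} (X.AL L)} (τ : (X.pull L).obj M ⟶ M) (x : X.AL L) (m : M) :
    semi τ (x • m) = X.sig L x • semi τ m := by
  rw [semi, pullMk_smul]
  exact map_smul τ.hom _ _

theorem semi_zero {M : ModuleCat.{u} (X.AL L)} (τ : (X.pull L).obj M ⟶ M) :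
    semi τ 0 = 0 := by
  simpa using semi_smul τ 0 0

theorem semi_sum {M : ModuleCat.{u} (X.AL L)} (τ : (X.pull L).obj M ⟶ M) {ι : Type*} (s : Finset ι)
    (m : ι → M) : semi τ (∑ i ∈ s, m i) = ∑ i ∈ s, semi τ (m i) :=
  map_sum (AddMonoidHom.mk' (semi τ) (semi_add τ)) m s

end PointedCurve

namespace PureAndersonMotive

open PointedCurve

variable {Fq : Type u} [Field Fq] [Finite Fq] {X : PointedCurve Fq}
    {L : Type u} [Field L] [Algebra Fq L] {c : X.A →ₐ[Fq] L} {r d r' d' : ℕ}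

theorem Hom.apply_semi {M : PureAndersonMotive X c r d} {M' : PureAndersonMotive X c r' d'}
    (f : Hom M M') (m : M.M) : f.1 (semi M.τ m) = semi M'.τ (f.1 m) :=
  congrArg (fun g => g (pullMk m)) (mem_Hom.1 f.2)

/-- `τ` is right cancellable among linear maps into the module of `M'`. -/
def TauCancel (M : PureAndersonMotive X c r d) (M' : PureAndersonMotive X c r' d') : Prop :=
  ∀ g : M.M →ₗ[X.AL L] M'.M, (∀ m, g (semi M.τ m) = 0) → g = 0

/-- Induction on the length of the relation, as in Dedekind's independence of characters: morphisms
commute with τ, while τ raises the coefficients to the q-th power. -/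
theorem sum_smul_eq_zero {M : PureAndersonMotive X c r d} {M' : PureAndersonMotive X c r' d'}
    (hc : TauCancel M M') {ι : Type*} (s : Finset ι) (b : ι → L)
    (hb : LinearIndepOn Fq b (s : Set ι)) (g : ι → Hom M M')
    (h : ∑ i ∈ s, ((1 : X.A) ⊗ₜ[Fq] b i : X.AL L) • (g i).1.hom = 0) : ∀ i ∈ s, g i = 0 := by
  classical
  let := Fintype.ofFinite Fq
  induction s using Finset.induction_on generalizing b with
  | empty => simp
  | insert j s hj ih =>
    rw [Finset.coe_insert] at hb
    have hbj : b j ≠ 0 := hb.ne_zero (Set.mem_insert _ _)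
    wlog hb1 : b j = 1 generalizing b
    · refine this (fun i => (b j)⁻¹ * b i) ?_ ?_ ?_ ?_
      · have := hb.map_injOn (LinearMap.mulLeft Fq (b j)⁻¹)
          (mul_right_injective₀ (inv_ne_zero hbj)).injOn
        exact this
      · have := congrArg (fun f => ((1 : X.A) ⊗ₜ[Fq] (b j)⁻¹ : X.AL L) • f) h
        simpa [Finset.smul_sum, smul_smul] using this
      · simp [hbj]
      · simp [hbj]
    have hfrob : ∑ i ∈ insert j s, ((1 : X.A) ⊗ₜ[Fq] (b i ^ Fintype.card Fq) : X.AL L) •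
        (g i).1.hom = 0 := by
      refine hc _ fun m => ?_
      have := congrArg (fun f => semi M'.τ (f m)) h
      simp only [LinearMap.sum_apply, LinearMap.smul_apply, semi_sum, semi_smul,
        LinearMap.zero_apply, semi_zero] at this ⊢
      rw [← this]
      refine Finset.sum_congr rfl fun i _ => ?_
      refine congrArg₂ _ ?_ (Hom.apply_semi (g i) m)
      rw [sig, Algebra.TensorProduct.map_tmul]
      simp [frob]
    -- The term at j drops out since 1^q − 1 = 0.
    have key := ih (fun i => b i ^ Fintype.card Fq - b i) (hb.pow_card_sub hj hb1) (by
      have := congrArg₂ (· - ·) hfrob h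
      simpa [← Finset.sum_sub_distrib, ← sub_smul, ← TensorProduct.tmul_sub, hj, hb1] using this)
    intro i hi
    rcases Finset.mem_insert.1 hi with rfl | hi
    · rw [Finset.sum_insert hj, Finset.sum_eq_zero, hb1, add_zero] at h
      · refine Subtype.ext (ModuleCat.hom_ext ?_)
        simpa [Algebra.TensorProduct.one_def.symm] using h
      · intro k hk
        rw [key k hk]
        exact smul_zero _
    · exact key i hi

/-- The canonical map `A_L ⊗_A Hom(M, M') → Hom_{A_L}(M, M')`. -/
def homBaseChange (M : PureAndersonMotive X c r d) (M' : PureAndersonMotive X c r' d') :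
    X.AL L ⊗[X.A] Hom M M' →ₗ[X.AL L] (M.M →ₗ[X.AL L] M'.M) :=
  letI : Module X.A (M.M →ₗ[X.AL L] M'.M) := Module.compHom _ (algebraMap X.A (X.AL L))
  haveI : IsScalarTower X.A (X.AL L) (M.M →ₗ[X.AL L] M'.M) :=
    IsScalarTower.of_algebraMap_smul fun _ _ => rfl
  LinearMap.liftBaseChange (X.AL L)
    { toFun := fun f => f.1.hom
      map_add' := fun _ _ => rfl
      map_smul' := fun _ _ => rfl }

theorem homBaseChange_tmul {M : PureAndersonMotive X c r d} {M' : PureAndersonMotive X c r' d'}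
    (x : X.AL L) (f : Hom M M') : homBaseChange M M' (x ⊗ₜ f) = x • f.1.hom := rfl

/-- Morphisms of motives that are independent over `A` stay independent over `A_L`. The finiteness
of `Hom(M, M')` follows by descent along `A → A_L`; purity is not needed for it. -/
theorem homBaseChange_injective {M : PureAndersonMotive X c r d}
    {M' : PureAndersonMotive X c r' d'} (hc : TauCancel M M') :
    Function.Injective (homBaseChange M M') := by
  classical
  rw [injective_iff_map_eq_zero]
  intro x hx
  let b := Module.Free.chooseBasis Fq L
  let B := Algebra.TensorProduct.basis X.A b
  obtain ⟨g, rfl⟩ := TensorProduct.eq_repr_basis_left B x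
  have := sum_smul_eq_zero hc g.support b (b.linearIndependent.linearIndepOn _) g (by
    rw [Finsupp.sum, map_sum] at hx
    simpa [homBaseChange_tmul, B] using hx)
  have hg : g = 0 := by
    ext1 i
    by_contra hi
    exact hi (this i (Finsupp.mem_support_iff.2 hi))
  simp [hg]

end PureAndersonMotive

/-! ### Ranks of Hom modules and nonzerodivisors in A ⊗ L -/

theorem Module.rank_linearMap_le_of_rankAtStalk {R M N : Type*} [CommRing R] [IsNoetherianRing R]
    [AddCommGroup M] [Module R M] [Module.Finite R M] [Module.Projective R M]
    [AddCommGroup N] [Module R N] [Module.Finite R N] [Module.Projective R N]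
    (p : PrimeSpectrum R) {ι : Type*} [Fintype ι] {v : ι → M →ₗ[R] N} (hv : LinearIndependent R v) :
    Fintype.card ι ≤ Module.rankAtStalk M p * Module.rankAtStalk N p := by
  let S := p.asIdeal.primeCompl
  have : Module.FinitePresentation R M := Module.finitePresentation_of_finite R M
  have h := hv.of_isLocalizedModule (Localization.AtPrime p.asIdeal) S
    (LocalizedModule.map S (M := M) (N := N))
  have h1 : Module.Free (Localization.AtPrime p.asIdeal) (LocalizedModule S M) :=
    Module.free_of_flat_of_isLocalRing
  have h2 : Module.Free (Localization.AtPrime p.asIdeal) (LocalizedModule S N) :=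
    Module.free_of_flat_of_isLocalRing
  have := h.fintype_card_le_finrank
  rwa [Module.finrank_linearMap] at this

/-- Contracting u with all functionals on L gives a finite-dimensional k-subspace of A. It is stable
under a, because multiplying by a amounts to precomposing functionals with multiplication by l. Were
it nonzero, a would be integral over k. -/
theorem Algebra.TensorProduct.eq_zero_of_tmul_one_mul_eq {k A L : Type*} [Field k] [CommRing A]
    [IsDomain A] [Algebra k A] [CommRing L] [Algebra k L] {a : A} (ha : Transcendental k a) (l : L)
    {u : A ⊗[k] L} (h : a ⊗ₜ[k] (1 : L) * u = (1 : A) ⊗ₜ[k] l * u) : u = 0 := by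
  classical
  -- `ev u φ` is (id ⊗ φ)(u).
  let ev : A ⊗[k] L →ₗ[k] (L →ₗ[k] k) →ₗ[k] A :=
    LinearMap.flip
      { toFun := fun φ => (_root_.TensorProduct.rid k A).toLinearMap ∘ₗ φ.lTensor A
        map_add' := fun φ ψ => by rw [LinearMap.lTensor_add, LinearMap.comp_add]
        map_smul' := fun x φ => by rw [LinearMap.lTensor_smul, LinearMap.comp_smul]; rfl }
  have ev_tmul (x : A) (y : L) (φ : L →ₗ[k] k) : ev (x ⊗ₜ y) φ = φ y • x := by simp [ev]
  have hfg : (LinearMap.range (ev u)).FG := by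
    clear h
    induction u with
    | zero => rw [map_zero, LinearMap.range_zero]; exact Submodule.fg_bot
    | tmul x y =>
      refine Submodule.FG.of_le (Submodule.fg_span_singleton x) ?_
      rintro _ ⟨φ, rfl⟩
      rw [ev_tmul]
      exact Submodule.smul_mem _ _ (Submodule.mem_span_singleton_self x)
    | add u v hu hv =>
      refine Submodule.FG.of_le (hu.sup hv) ?_
      rintro _ ⟨φ, rfl⟩
      rw [map_add]
      exact Submodule.add_mem_sup ⟨φ, rfl⟩ ⟨φ, rfl⟩
  have hl (φ : L →ₗ[k] k) (u : A ⊗[k] L) :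
      ev ((1 : A) ⊗ₜ[k] l * u) φ = ev u (φ ∘ₗ LinearMap.mulLeft k l) := by
    induction u with
    | zero => simp
    | tmul x y => simp [ev_tmul]
    | add u v hu hv => rw [mul_add, map_add, LinearMap.add_apply, hu, hv, map_add]; rfl
  have hr (φ : L →ₗ[k] k) (u : A ⊗[k] L) : ev (a ⊗ₜ[k] (1 : L) * u) φ = a * ev u φ := by
    induction u with
    | zero => simp
    | tmul x y => simp [ev_tmul]
    | add u v hu hv => rw [mul_add, map_add, LinearMap.add_apply, hu, hv, ← mul_add, map_add]; rfl
  by_contra hu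
  refine ha (_root_.IsIntegral.isAlgebraic ?_)
  refine isIntegral_of_smul_mem_submodule (M := A) (N := LinearMap.range (ev u)) ?_ hfg a ?_
  · intro h0
    refine hu ?_
    let b := Module.Free.chooseBasis k L
    apply (TensorProduct.equivFinsuppOfBasisRight (M := A) b).injective
    ext1 i
    rw [TensorProduct.equivFinsuppOfBasisRight_apply, map_zero, Finsupp.zero_apply]
    have : ev u (b.coord i) ∈ LinearMap.range (ev u) := ⟨_, rfl⟩
    rwa [h0] at this
  · rintro _ ⟨φ, rfl⟩
    exact ⟨φ ∘ₗ LinearMap.mulLeft k l, by rw [← hl, ← h, hr]; rfl⟩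

theorem ModuleCat.finite_extendScalars {R S : Type u} [CommRing R] [CommRing S]
    (f : R →+* S) (M : ModuleCat.{u} R) [Module.Finite R M] :
    Module.Finite S ((ModuleCat.extendScalars f).obj M) := by
  let := f.toAlgebra
  exact inferInstanceAs (Module.Finite S (S ⊗[R] M))

theorem ModuleCat.finrank_extendScalars {R S : Type u} [CommRing R] [CommRing S]
    [StrongRankCondition S] (f : R →+* S) (M : ModuleCat.{u} R) [Module.Free R M] [StrongRankCondition R] :
    Module.finrank S ((ModuleCat.extendScalars f).obj M) = Module.finrank R M := by
  let := f.toAlgebra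
  exact Module.finrank_baseChange (R := S) (S := R) (M' := M)

/-! ### Cancelling τ, and the properties of Hom(M, M') -/

namespace PureAndersonMotive

open PointedCurve

variable {Fq : Type u} [Field Fq] [Finite Fq] {X : PointedCurve Fq}
    {L : Type u} [Field L] [Algebra Fq L] {c : X.A →ₐ[Fq] L} {r d r' d' : ℕ}

attribute [instance] PureAndersonMotive.finite PureAndersonMotive.projective

omit [Finite Fq] in
theorem nontrivial_AL (c : X.A →ₐ[Fq] L) : Nontrivial (X.AL L) :=
  (Algebra.TensorProduct.lift c (AlgHom.id Fq L) fun _ _ => Commute.all _ _).toRingHom.domain_nontrivial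

/-- Since xM lies in the image of τ, xg = 0; and x is regular on the flat module M'. -/
theorem tauCancel_of_nonZeroDivisor {M : PureAndersonMotive X c r d} {M' : PureAndersonMotive X c r' d'}
    (x : X.AL L) (hx : x ∈ nonZeroDivisors (X.AL L)) 
    (hM : x ∈ Module.annihilator (X.AL L) (M.M ⧸ LinearMap.range M.τ.hom)) : TauCancel M M' := by
  intro g hg
  have h0 : M.τ ≫ ModuleCat.ofHom g = 0 := pull_hom_ext hg
  ext m
  refine Module.Flat.isSMulRegular_of_nonZeroDivisors hx ?_
  have := Module.mem_annihilator.1 hM (Submodule.Quotient.mk m)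
  rw [← Submodule.Quotient.mk_smul, Submodule.Quotient.mk_eq_zero] at this
  obtain ⟨y, hy⟩ := this
  have h1 : g (M.τ.hom y) = 0 := congrArg (fun f => f.hom y) h0
  rw [hy, map_smul] at h1
  simpa using h1

theorem tauCancel_of_transcendental [IsDomain X.A] (a : X.A) (ha : Transcendental Fq a)
    (M : PureAndersonMotive X c r d) (M' : PureAndersonMotive X c r' d') : TauCancel M M' := by
  refine tauCancel_of_nonZeroDivisor ((a ⊗ₜ[Fq] (1 : L) - (1 : X.A) ⊗ₜ[Fq] c a) ^ d) ?_
    (M.coker_annihilated (Ideal.pow_mem_pow (Ideal.subset_span (Set.mem_range_self a)) d))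
  refine pow_mem (mem_nonZeroDivisors_iff_left.2 fun u hu => ?_) d
  exact Algebra.TensorProduct.eq_zero_of_tmul_one_mul_eq ha (c a) (by rwa [sub_mul, sub_eq_zero] at hu)

/-- Here A_L = L is a field and σ^*M has the same dimension as M, so the injective τ is surjective.
-/
theorem tauCancel_of_bijective (h : Function.Bijective (algebraMap Fq X.A))
    (M : PureAndersonMotive X c r d) (M' : PureAndersonMotive X c r' d') : TauCancel M M' := by
  have := nontrivial_AL c
  have hF : IsField (X.AL L) := by
    let i : L →+* X.AL L := (Algebra.TensorProduct.includeRight : L →ₐ[Fq] X.AL L).toRingHom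
    have hi : Function.Surjective i := by
      intro x
      induction x using TensorProduct.induction_on with
      | zero => exact ⟨0, map_zero i⟩
      | tmul a b =>
        obtain ⟨y, rfl⟩ := h.2 a
        exact ⟨y • b, by
          change (1 : X.A) ⊗ₜ[Fq] (y • b) = _
          rw [← smul_tmul, Algebra.algebraMap_eq_smul_one]⟩
      | add x y hx hy =>
        obtain ⟨x, rfl⟩ := hx
        obtain ⟨y, rfl⟩ := hy
        exact ⟨x + y, map_add i x y⟩
    exact (RingEquiv.ofBijective i ⟨i.injective, hi⟩).symm.toMulEquiv.isField (Field.toIsField L)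
  let := hF.toField
  have : Module.Finite (X.AL L) ((X.pull L).obj M.M) := ModuleCat.finite_extendScalars _ _
  have hr : Module.finrank (X.AL L) ((X.pull L).obj M.M) = Module.finrank (X.AL L) M.M :=
    ModuleCat.finrank_extendScalars _ _
  have hs : Function.Surjective M.τ.hom :=
    (LinearMap.injective_iff_surjective_of_finrank_eq_finrank hr).1 M.injective
  refine tauCancel_of_nonZeroDivisor 1 (one_mem _) (Module.mem_annihilator.2 fun m => ?_)
  obtain ⟨m, rfl⟩ := Submodule.Quotient.mk_surjective _ m
  rw [one_smul, Submodule.Quotient.mk_eq_zero]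
  exact hs m

theorem finite_hom [IsNoetherianRing (X.AL L)] {M : PureAndersonMotive X c r d}
    {M' : PureAndersonMotive X c r' d'} (hc : TauCancel M M') : Module.Finite X.A (Hom M M') := by
  have := nontrivial_AL c
  have : Module.Finite (X.AL L) (X.AL L ⊗[X.A] Hom M M') :=
    Module.Finite.of_injective _ (homBaseChange_injective hc)
  exact Module.Finite.of_finite_tensorProduct_of_faithfullyFlat (X.AL L)

/-- Independence over A survives the flat base change to A_L and the injection into Hom_{A_L}(M,
M'), where it can be counted at any one prime. -/
theorem rank_hom_le [IsNoetherianRing (X.AL L)] {M : PureAndersonMotive X c r d}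
    {M' : PureAndersonMotive X c r' d'} (hc : TauCancel M M') :
    Module.rank X.A (Hom M M') ≤ ((r * r' : ℕ) : Cardinal) := by
  have := nontrivial_AL c
  refine rank_le fun s hs => ?_
  have h := (Module.Flat.linearIndependent_one_tmul (S := X.AL L) hs).map'
    (homBaseChange M M') (LinearMap.ker_eq_bot.2 (homBaseChange_injective hc))
  obtain ⟨p⟩ : Nonempty (PrimeSpectrum (X.AL L)) := inferInstance
  have := Module.rank_linearMap_le_of_rankAtStalk p h
  rwa [M.rank_eq, M'.rank_eq, Fintype.card_coe] at this

theorem projective_hom [IsNoetherianRing (X.AL L)] [IsDedekindDomain X.A]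
    {M : PureAndersonMotive X c r d} {M' : PureAndersonMotive X c r' d'} (hc : TauCancel M M') :
    Module.Projective X.A (Hom M M') := by
  have := finite_hom hc
  -- A nonzero a stays a nonzerodivisor in the flat A-algebra A_L, hence acts injectively on the
  -- flat module M'.
  have : Module.IsTorsionFree X.A (Hom M M') := by
    refine .of_smul_eq_zero fun a f h => or_iff_not_imp_left.2 fun ha => ?_
    have := nontrivial_AL c
    have hreg : (a ⊗ₜ[Fq] (1 : L) : X.AL L) ∈ nonZeroDivisors (X.AL L) :=
      mem_nonZeroDivisors_iff_left.2 fun y hy =>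
        Module.Flat.isSMulRegular_of_nonZeroDivisors (mem_nonZeroDivisors_of_ne_zero ha)
          (((Algebra.smul_def a y).trans hy).trans (smul_zero a).symm)
    refine Subtype.ext (ModuleCat.hom_ext (LinearMap.ext fun m => ?_))
    refine Module.Flat.isSMulRegular_of_nonZeroDivisors hreg ?_
    exact (congrArg (fun g : Hom M M' => g.1.hom m) h).trans (smul_zero _).symm
  have : Module.FinitePresentation X.A (Hom M M') := Module.finitePresentation_of_finite _ _
  exact Module.Flat.projective_of_finitePresentation

end PureAndersonMotive

/-! ### Local rings of a smooth curve -/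

/-- Noetherian local domains whose maximal ideal is principal, that is, fields and discrete
valuation rings. -/
structure IsFieldOrDVR (R : Type*) [CommRing R] : Prop where
  isLocalRing : IsLocalRing R
  isDomain : IsDomain R
  isPrincipalIdealRing : IsPrincipalIdealRing R

theorem IsFieldOrDVR.of_ringEquiv {R S : Type*} [CommRing R] [CommRing S] (e : R ≃+* S)
    (h : IsFieldOrDVR R) : IsFieldOrDVR S := by
  have := h.1; have := h.2; have := h.3
  exact ⟨e.isLocalRing, e.symm.toMulEquiv.isDomain _, .of_surjective e.toRingHom e.surjective⟩

/-- By Krull's intersection theorem there is a last power of the maximal ideal containing x. The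
ring is not assumed to be a domain, because this factorisation serves to prove that it is one. -/
theorem IsLocalRing.eq_unit_mul_pow {R : Type*} [CommRing R] [IsLocalRing R]
    [IsNoetherianRing R] {z : R} (hz : maximalIdeal R = Ideal.span {z}) {x : R} (hx : x ≠ 0) :
    ∃ (u : R) (n : ℕ), IsUnit u ∧ x = u * z ^ n := by
  classical
  have h : ∃ n, x ∉ maximalIdeal R ^ n := by
    by_contra! h
    have : x ∈ ⨅ n, maximalIdeal R ^ n := (Ideal.mem_iInf).2 h
    rw [Ideal.iInf_pow_eq_bot_of_isLocalRing _ (maximalIdeal.isMaximal R).ne_top] at this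
    exact hx this
  obtain ⟨n, hn⟩ : ∃ n, Nat.find h = n + 1 :=
    Nat.exists_eq_succ_of_ne_zero fun h0 => Nat.find_spec h (by simp [h0])
  have h1 := Nat.find_spec h
  have h2 : x ∈ maximalIdeal R ^ n := not_not.1 (Nat.find_min h (by lia))
  rw [hn] at h1
  rw [hz, Ideal.span_singleton_pow, Ideal.mem_span_singleton'] at h1 h2
  obtain ⟨u, rfl⟩ := h2
  refine ⟨u, n, ?_, rfl⟩
  by_contra hu
  have : u ∈ maximalIdeal R := hu
  rw [hz, Ideal.mem_span_singleton'] at this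
  obtain ⟨v, rfl⟩ := this
  exact h1 ⟨v, by ring⟩

theorem IsLocalRing.isDomain_of_maximalIdeal_eq_span {R : Type*} [CommRing R] [IsLocalRing R]
    [IsNoetherianRing R] {z : R} (hz : maximalIdeal R = Ideal.span {z}) (h : z = 0 ∨ ¬ IsNilpotent z) :
    IsDomain R := by
  rcases h with rfl | h
  · have : IsField R := isField_iff_maximalIdeal_eq.2 (by simpa using hz)
    exact this.isDomain
  · have : NoZeroDivisors R := ⟨fun {a b} hab => by
      by_contra! hne
      obtain ⟨u, n, hu, rfl⟩ := eq_unit_mul_pow hz hne.1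
      obtain ⟨v, m, hv, rfl⟩ := eq_unit_mul_pow hz hne.2
      refine h ⟨n + m, (hu.mul hv).mul_right_eq_zero.1 (by rw [← hab]; ring)⟩⟩
    exact NoZeroDivisors.to_isDomain R

theorem IsLocalRing.isFieldOrDVR {R : Type*} [CommRing R] [IsLocalRing R]
    [IsNoetherianRing R] {z : R} (hz : maximalIdeal R = Ideal.span {z}) (h : z = 0 ∨ ¬ IsNilpotent z) :
    IsFieldOrDVR R := by
  have := isDomain_of_maximalIdeal_eq_span hz h
  exact ⟨inferInstance, this,
    ((tfae_of_isNoetherianRing_of_isLocalRing_of_isDomain R).out 4 0).1 (by exact ⟨z, hz⟩)⟩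

/-- Unramifiedness makes a generator of the prime below generate the maximal ideal; flatness keeps
it non-nilpotent unless it is zero. -/
theorem Algebra.Etale.isFieldOrDVR_localization {R S : Type*} [CommRing R] [IsDomain R]
    [IsPrincipalIdealRing R] [CommRing S] [Algebra R S] [Algebra.Etale R S]
    (P : Ideal S) [P.IsPrime] : IsFieldOrDVR (Localization.AtPrime P) := by
  have : IsNoetherianRing S := Algebra.FiniteType.isNoetherianRing R S
  have : IsNoetherianRing (Localization.AtPrime P) :=
    IsLocalization.isNoetherianRing P.primeCompl _ inferInstance
  let p := P.under R
  let z := Submodule.IsPrincipal.generator p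
  let := Localization.AtPrime.algebraOfLiesOver p P
  have hu := ((Algebra.isUnramifiedAt_iff_map_eq R p P).1 inferInstance).2
  rw [← Ideal.span_singleton_generator p, Ideal.map_span, Set.image_singleton] at hu
  refine IsLocalRing.isFieldOrDVR hu.symm (or_iff_not_imp_left.2 fun h0 => ?_)
  have : Module.Flat R (Localization.AtPrime P) := Module.Flat.trans R S _
  rintro ⟨n, hn⟩
  have hz : z ^ n ≠ 0 := pow_ne_zero n fun h => h0 (by rw [show Submodule.IsPrincipal.generator p = 0 from h, map_zero])
  refine one_ne_zero (α := Localization.AtPrime P)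
    (Module.Flat.isSMulRegular_of_nonZeroDivisors (mem_nonZeroDivisors_of_ne_zero hz) ?_)
  change z ^ n • (1 : Localization.AtPrime P) = z ^ n • 0
  rw [smul_zero, ← Algebra.algebraMap_eq_smul_one, map_pow]
  exact hn

namespace AlgebraicGeometry

/-- Locally the curve is étale over the affine line, whose coordinate ring k[x] is principal. -/
theorem isFieldOrDVR_stalk {k : Type u} [Field k] {Y : Scheme.{u}} (f : Y ⟶ Spec (CommRingCat.of k))
    [hf : SmoothOfRelativeDimension 1 f] (y : Y) : IsFieldOrDVR (Y.presheaf.stalk y) := by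
  obtain ⟨U, hU, V, hV, hy, e, hf⟩ := hf.exists_isStandardSmoothOfRelativeDimension y
  have hUtop : U = ⊤ := by
    ext z
    simp [show z = f y from Subsingleton.elim _ _, show f y ∈ U from e hy]
  subst hUtop
  have hF : IsField Γ(Spec (CommRingCat.of k), ⊤) :=
    (Scheme.ΓSpecIso (CommRingCat.of k)).commRingCatIsoToRingEquiv.toMulEquiv.isField
      (Field.toIsField k)
  let := hF.toField
  obtain ⟨g, -, hg⟩ := hf.exists_etale_mvPolynomial
  let e := MvPolynomial.uniqueAlgEquiv Γ(Spec (CommRingCat.of k), ⊤) (Fin 1)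
  have : IsPrincipalIdealRing (MvPolynomial (Fin 1) Γ(Spec (CommRingCat.of k), ⊤)) :=
    .of_surjective e.symm.toRingEquiv.toRingHom e.symm.surjective
  algebraize [g]
  let := TopCat.Presheaf.algebra_section_stalk Y.presheaf (⟨y, hy⟩ : V)
  have := hV.isLocalization_stalk ⟨y, hy⟩
  refine (Algebra.Etale.isFieldOrDVR_localization
    (R := MvPolynomial (Fin 1) Γ(Spec (CommRingCat.of k), ⊤))
    (hV.primeIdealOf ⟨y, hy⟩).asIdeal).of_ringEquiv ?_
  exact (IsLocalization.algEquiv (hV.primeIdealOf ⟨y, hy⟩).asIdeal.primeCompl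
    (Localization.AtPrime (hV.primeIdealOf ⟨y, hy⟩).asIdeal) (Y.presheaf.stalk y)).toRingEquiv

theorem isIntegral_of_isDomain_stalk {Y : Scheme.{u}} [IrreducibleSpace Y]
    (h : ∀ y : Y, IsDomain (Y.presheaf.stalk y)) : IsIntegral Y := by
  have : IsReduced Y := isReduced_of_isReduced_stalk Y
  exact isIntegral_of_irreducibleSpace_of_isReduced Y

/-- A rational function that is regular at every point of an open set is a section over it. -/
theorem exists_germToFunctionField_eq {Y : Scheme.{u}} [IsIntegral Y] (U : Y.Opens) [Nonempty U]
    (x : Y.functionField) (hx : ∀ y ∈ U, x ∈ Set.range (algebraMap (Y.presheaf.stalk y) Y.functionField)) :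
    x ∈ Set.range (Y.germToFunctionField U) := by
  have (y : {y // y ∈ U}) : ∃ (V : Y.Opens) (hy : y.1 ∈ V) (hV : V ≤ U) (s : Γ(Y, V)),
      ∀ [Nonempty V], Y.germToFunctionField V s = x := by
    obtain ⟨t, ht⟩ := hx y y.2
    obtain ⟨V, hV, s, rfl⟩ := Y.presheaf.exists_germ_eq t
    refine ⟨V ⊓ U, And.intro hV y.2, inf_le_right, Y.presheaf.map (homOfLE inf_le_left).op s, fun {_} => ?_⟩
    rw [← ht, ← Scheme.algebraMap_germ_eq_germToFunctionField Y (x := y.1) (And.intro hV y.2)]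
    exact congrArg _ (TopCat.Presheaf.germ_res_apply _ _ _ _ _)
  choose V hyV hVU s hs using this
  obtain ⟨t, ht, -⟩ := Y.sheaf.existsUnique_gluing' V U (fun y => homOfLE (hVU y))
    (fun y hy => Opens.mem_iSup.2 ⟨⟨y, hy⟩, hyV _⟩) s (by
      intro i j
      -- All the V i share the generic point, so agreement on overlaps can be tested in the function
      -- field.
      have hg (i) : genericPoint Y ∈ V i :=
        ((genericPoint_spec Y).mem_open_set_iff (V i).isOpen).2 ⟨i.1, trivial, hyV i⟩
      have hne (i) : Nonempty (V i) := ⟨⟨_, hg i⟩⟩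
      have hn : Nonempty (V i ⊓ V j : Y.Opens) := ⟨⟨genericPoint Y, And.intro (hg i) (hg j)⟩⟩
      apply Y.germToFunctionField_injective (V i ⊓ V j)
      refine (TopCat.Presheaf.germ_res_apply _ _ _ _ _).trans ((hs i).trans ?_)
      exact (hs j).symm.trans (TopCat.Presheaf.germ_res_apply _ _ _ _ _).symm)
  refine ⟨t, ?_⟩
  obtain ⟨y, hy⟩ := ‹Nonempty U›
  let y : {y // y ∈ U} := ⟨y, hy⟩
  have : Nonempty (V y) := ⟨⟨y.1, hyV y⟩⟩
  rw [← hs y, ← ht y]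
  exact (TopCat.Presheaf.germ_res_apply _ _ _ _ _).symm

end AlgebraicGeometry

/-! ### Finiteness from the pole-order filtration -/

/-- Finiteness over `k[a]` of an algebra filtered by pole order. Here `P n x` says that `x` has a
pole of order at most `n`, and `E n x` that the order is exactly `n`. -/
theorem Polynomial.aeval_finite_of_filtration {k A : Type*} [Field k] [CommRing A] [Algebra k A]
    (P E : ℕ → A → Prop) (hPE : ∀ n x, P (n + 1) x → P n x ∨ E (n + 1) x)
    (hE1 : E 0 1) (hmul : ∀ m n x y, E m x → E n y → E (m + n) (x * y))
    (hsub : ∀ n x y, P (n + 1) x → E (n + 1) y → ∃ l : k, P n (x - l • y))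
    (hex : ∀ x, ∃ n, P n x) (G : Submodule k A) (hG : G.FG) (hP0 : ∀ x, P 0 x → x ∈ G)
    {a : A} (ha : ¬ P 0 a) : (Polynomial.aeval (R := k) a).toRingHom.Finite := by
  classical
  obtain ⟨p, hp⟩ : ∃ p, E (p + 1) a := by
    have h0 : Nat.find (hex a) ≠ 0 := fun h => ha (by rw [← h]; exact Nat.find_spec (hex a))
    obtain ⟨n, hn⟩ := Nat.exists_eq_succ_of_ne_zero h0
    refine ⟨n, (hPE n a (by rw [← Nat.succ_eq_add_one, ← hn]; exact Nat.find_spec (hex a))).resolve_left ?_⟩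
    exact Nat.find_min (hex a) (by lia)
  have hpow (j : ℕ) : E ((p + 1) * j) (a ^ j) := by
    induction j with
    | zero => simpa using hE1
    | succ j ih => simpa [pow_succ, mul_add] using hmul _ _ _ _ ih hp
  -- In each residue class modulo the pole order p + 1 of a, pick y of least pole order; 0 is a
  -- dummy value for classes that do not occur.
  have hy (i : Fin (p + 1)) : ∃ y : A, ∀ m, m % (p + 1) = i → (∃ x, E m x) →
      ∃ m' j, m = m' + (p + 1) * j ∧ E m' y := by
    by_cases h : ∃ m, m % (p + 1) = i ∧ ∃ x, E m x
    · obtain ⟨hi, y, hy⟩ := Nat.find_spec h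
      refine ⟨y, fun m hm hx => ⟨_, (m - Nat.find h) / (p + 1), ?_, hy⟩⟩
      have hle : Nat.find h ≤ m := Nat.find_min' h ⟨hm, hx⟩
      have : (p + 1) ∣ m - Nat.find h := (Nat.modEq_iff_dvd' hle).1 (hi.trans hm.symm)
      rw [Nat.mul_div_cancel' this]
      lia
    · exact ⟨0, fun m hm hx => (h ⟨m, hm, hx⟩).elim⟩
  choose y hy using hy
  algebraize [(Polynomial.aeval (R := k) a).toRingHom]
  have : IsScalarTower k (Polynomial k) A := .of_algebraMap_eq fun x => by
    simp [RingHom.algebraMap_toAlgebra]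
  obtain ⟨g, rfl⟩ := hG
  let N := Submodule.span (Polynomial k) ((g : Set A) ∪ Set.range y)
  have hN (n : ℕ) : ∀ x, P n x → x ∈ N := by
    induction n with
    | zero =>
      intro x hx
      refine Submodule.span_mono Set.subset_union_left ?_
      exact Submodule.span_le_restrictScalars k (Polynomial k) (g : Set A) (hP0 x hx)
    | succ n ih =>
      intro x hx
      rcases hPE n x hx with h | h
      · exact ih x h
      obtain ⟨m', j, hm, hE⟩ := hy ⟨(n + 1) % (p + 1), Nat.mod_lt _ p.succ_pos⟩ (n + 1) rfl ⟨x, h⟩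
      set w := y ⟨(n + 1) % (p + 1), Nat.mod_lt _ p.succ_pos⟩
      -- This has the same pole order as x, so subtracting a scalar multiple lowers the order.
      have hE' : E (n + 1) (w * a ^ j) := by
        rw [hm]; exact hmul _ _ _ _ hE (hpow j)
      obtain ⟨l, hl⟩ := hsub n x _ hx hE'
      rw [← sub_add_cancel x (l • (w * a ^ j))]
      refine N.add_mem (ih _ hl) ?_
      have : l • (w * a ^ j) = (Polynomial.C l * Polynomial.X ^ j : Polynomial k) • w := by
        rw [Algebra.smul_def, Algebra.smul_def, RingHom.algebraMap_toAlgebra]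
        simp; ring
      rw [this]
      exact N.smul_mem _ (Submodule.subset_span (Or.inr ⟨_, rfl⟩))
  refine (⟨⟨g ∪ Finset.univ.image y, ?_⟩⟩ : Module.Finite (Polynomial k) A)
  rw [Finset.coe_union, Finset.coe_image, Finset.coe_univ, Set.image_univ, eq_top_iff]
  intro x _
  obtain ⟨n, hn⟩ := hex x
  exact hN n x hn

/-- With z a uniformiser of O, the pole order of x is at most n when z^n x lies in O. Residues
coming from k allow leading terms to be cancelled. -/
theorem Polynomial.aeval_finite_of_isFieldOrDVR {k K A O : Type*} [Field k] [Field K] [CommRing A]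
    [CommRing O] [Algebra k A] [Algebra k O] [Algebra k K] [Algebra A K] [Algebra O K]
    [IsScalarTower k A K] [IsScalarTower k O K] [IsFractionRing O K] (hO : IsFieldOrDVR O)
    (hres : ∀ o : O, ∃ l : k, ¬ IsUnit (o - algebraMap k O l))
    (G : Submodule k A) (hG : G.FG)
    (hAO : ∀ x : A, algebraMap A K x ∈ Set.range (algebraMap O K) → x ∈ G)
    {a : A} (ha : algebraMap A K a ∉ Set.range (algebraMap O K)) :
    Transcendental k a ∧ (Polynomial.aeval (R := k) a).toRingHom.Finite := by
  have := hO.1; have := hO.2; have := hO.3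
  obtain ⟨z, hz⟩ := IsPrincipalIdealRing.principal (IsLocalRing.maximalIdeal O)
  have hz : IsLocalRing.maximalIdeal O = Ideal.span {z} := hz
  have hunit (o : O) (h : ¬ IsUnit o) : ∃ w, o = z * w := by
    have : o ∈ IsLocalRing.maximalIdeal O := h
    rwa [hz, Ideal.mem_span_singleton] at this
  have hinj := IsFractionRing.injective O K
  have hz0 : z ≠ 0 := by
    rintro rfl
    have hF : IsField O := IsLocalRing.isField_iff_maximalIdeal_eq.2 (by simpa using hz)
    exact ha ((IsField.localization_map_bijective (M := nonZeroDivisors O)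
      (by simp) hF).2 _)
  set ζ := algebraMap O K z with hζ
  have hζ0 : ζ ≠ 0 := (map_ne_zero_iff _ hinj).2 hz0
  refine ⟨fun h => ha ?_, ?_⟩
  -- An algebraic a would be integral over k, hence lie in the integrally closed ring O.
  · have h1 : IsIntegral k (algebraMap A K a) := (h.isIntegral).algebraMap
    exact IsIntegrallyClosed.isIntegral_iff.1 (h1.tower_top (A := O))
  refine Polynomial.aeval_finite_of_filtration
    (fun n x => ∃ o, ζ ^ n * algebraMap A K x = algebraMap O K o)
    (fun n x => ∃ o, IsUnit o ∧ ζ ^ n * algebraMap A K x = algebraMap O K o)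
    ?_ ?_ ?_ ?_ ?_ G hG ?_ ?_
  · rintro n x ⟨o, ho⟩
    by_cases hu : IsUnit o
    · exact Or.inr ⟨o, hu, ho⟩
    · obtain ⟨w, rfl⟩ := hunit o hu
      refine Or.inl ⟨w, mul_left_cancel₀ hζ0 ?_⟩
      rw [← mul_assoc, ← pow_succ', ho, map_mul]
  · exact ⟨1, isUnit_one, by simp⟩
  · rintro m n x y ⟨u, hu, hx⟩ ⟨v, hv, hy⟩
    exact ⟨u * v, hu.mul hv, by rw [map_mul, map_mul, ← hx, ← hy]; ring⟩
  · rintro n x y ⟨o, hx⟩ ⟨u, hu, hy⟩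
    obtain ⟨v, hv⟩ := hu.exists_left_inv
    obtain ⟨l, hl⟩ := hres (v * o)
    obtain ⟨w, hw⟩ := hunit _ hl
    refine ⟨l, u * w, mul_left_cancel₀ hζ0 ?_⟩
    have h1 : o - algebraMap k O l * u = z * (u * w) := by
      linear_combination u * hw - o * hv
    rw [← map_mul, ← h1, ← mul_assoc, ← pow_succ', map_sub, mul_sub, hx, map_sub, map_mul, ← hy,
      Algebra.smul_def, map_mul, ← IsScalarTower.algebraMap_apply, ← IsScalarTower.algebraMap_apply]
    ring
  · intro x
    obtain ⟨o, s, hs, h⟩ := IsFractionRing.div_surjective (A := O) (algebraMap A K x)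
    obtain ⟨u, n, hu, rfl⟩ := IsLocalRing.eq_unit_mul_pow hz (nonZeroDivisors.ne_zero hs)
    obtain ⟨v, hv⟩ := hu.exists_left_inv
    have hu0 : algebraMap O K u ≠ 0 := (map_ne_zero_iff _ hinj).2 hu.ne_zero
    refine ⟨n, v * o, ?_⟩
    have hv' : algebraMap O K v * algebraMap O K u = 1 := by rw [← map_mul, hv, map_one]
    rw [← h, map_mul, map_mul, map_pow, ← hζ]
    field_simp
    linear_combination -(algebraMap O K o) * hv'
  · rintro x ⟨o, ho⟩
    exact hAO x ⟨o, by simpa using ho.symm⟩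
  · rintro ⟨o, ho⟩
    exact ha ⟨o, by simpa using ho.symm⟩

theorem IsIntegrallyClosed.of_injective {A K : Type*} [CommRing A] [IsDomain A] [Field K]
    [Algebra A K] (hinj : Function.Injective (algebraMap A K))
    (h : ∀ x : K, IsIntegral A x → x ∈ Set.range (algebraMap A K)) : IsIntegrallyClosed A := by
  rw [isIntegrallyClosed_iff (FractionRing A)]
  intro x hx
  have : FaithfulSMul A K := (faithfulSMul_iff_algebraMap_injective A K).2 hinj
  let φ : FractionRing A →ₐ[A] K := IsFractionRing.liftAlgHom (g := Algebra.ofId A K) hinj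
  obtain ⟨a, ha⟩ := h (φ x) (hx.map φ)
  exact ⟨a, φ.toRingHom.injective ((φ.commutes a).trans ha)⟩

theorem IsDedekindDomain.of_moduleFinite (R A : Type*) [CommRing R] [Nontrivial R]
    [IsNoetherianRing R] [Ring.DimensionLEOne R] [CommRing A] [IsDomain A] [Algebra R A]
    [Module.Finite R A] [IsIntegrallyClosed A] : IsDedekindDomain A :=
  have := isNoetherian_of_isNoetherianRing_of_finite R A
  have : IsNoetherianRing A := isNoetherian_of_tower R this
  have := Ring.DimensionLEOne.of_isIntegral R A
  { }

/-! ### The coordinate ring A of C ∖ {∞} -/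

namespace AlgebraicGeometry

theorem germ_spec_surjective {k : Type u} [Field k] (x : Spec (CommRingCat.of k)) :
    Function.Surjective ((Spec (CommRingCat.of k)).presheaf.germ ⊤ x trivial) := by
  intro t
  obtain ⟨U, hU, s, rfl⟩ := (Spec (CommRingCat.of k)).presheaf.exists_germ_eq t
  have : U = ⊤ := by
    ext z
    simp [show z = x from Subsingleton.elim _ _, hU]
  subst this
  exact ⟨s, rfl⟩

end AlgebraicGeometry

namespace PointedCurve

variable {Fq : Type u} [Field Fq] (X : PointedCurve Fq)

theorem isFieldOrDVR_stalk (y : X.C) : IsFieldOrDVR (X.C.presheaf.stalk y) :=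
  have := X.smooth
  AlgebraicGeometry.isFieldOrDVR_stalk X.str y

theorem isIntegral_C : IsIntegral X.C := by
  have := X.geomIrred
  have : IrreducibleSpace X.C :=
    GeometricallyIrreducible.irreducibleSpace_of_subsingleton (f := X.str)
  exact isIntegral_of_isDomain_stalk fun y => (X.isFieldOrDVR_stalk y).2

theorem nonempty_Caff [Nontrivial X.A] : Nonempty X.Caff := by
  by_contra h
  have hb : X.Caff = ⊥ := by
    ext z
    exact ⟨fun hz => (h ⟨z, hz⟩).elim, fun hz => hz.elim⟩
  have h1 : Subsingleton Γ(X.C, X.Caff) := by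
    rw [hb]
    infer_instance
  exact not_subsingleton X.A h1

/-- The point `∞` of `C`. -/
def pt : X.C := X.inf (IsLocalRing.closedPoint Fq)

theorem mem_Caff_or_eq_pt (y : X.C) : y ∈ X.Caff ∨ y = X.pt := by
  by_cases h : y ∈ Set.range X.inf
  · obtain ⟨z, rfl⟩ := h
    exact Or.inr (congrArg _ (Subsingleton.elim _ _))
  · exact Or.inl h

/-- The structure map from `Fq` to the global functions. -/
def topMap : Fq →+* Γ(X.C, ⊤) :=
  ((Scheme.ΓSpecIso (CommRingCat.of Fq)).inv ≫ X.str.appTop).hom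

/-- The structure map from `Fq` to the local ring at `∞`. -/
def stalkMapInf : Fq →+* X.C.presheaf.stalk X.pt :=
  (X.C.presheaf.germ ⊤ X.pt trivial).hom.comp X.topMap

/-- The point ∞ is rational: l is the value of o along the section ∞, so o − l pulls back to zero in
a nonzero ring. -/
theorem exists_sub_not_isUnit (o : X.C.presheaf.stalk X.pt) :
    ∃ l : Fq, ¬ IsUnit (o - X.stalkMapInf l) := by
  obtain ⟨t, ht⟩ := germ_spec_surjective (IsLocalRing.closedPoint Fq)
    (X.inf.stalkMap (IsLocalRing.closedPoint Fq) o)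
  let e := (Scheme.ΓSpecIso (CommRingCat.of Fq)).commRingCatIsoToRingEquiv
  refine ⟨e t, fun hu => ?_⟩
  let φ : X.C.presheaf.stalk X.pt →+* (Spec (CommRingCat.of Fq)).presheaf.stalk _ :=
    (X.inf.stalkMap (IsLocalRing.closedPoint Fq)).hom
  have h := hu.map φ
  rw [map_sub] at h
  have hnt (Y : Scheme.{u}) (y : Y) : Nontrivial (Y.presheaf.stalk y) := inferInstance
  have := hnt (Spec (CommRingCat.of Fq)) (IsLocalRing.closedPoint Fq)
  refine h.ne_zero (sub_eq_zero.2 (ht.symm.trans ?_))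
  have h1 : X.topMap (e t) = X.str.appTop t := by
    change X.str.appTop (e.symm (e t)) = _
    rw [RingEquiv.symm_apply_apply]
  have h2 : X.inf.appTop (X.str.appTop t) = t := by
    rw [← CommRingCat.comp_apply, ← Scheme.Hom.comp_appTop, X.inf_str]
    simp
  rw [stalkMapInf, RingHom.comp_apply, h1]
  refine Eq.symm ((Scheme.Hom.germ_stalkMap_apply X.inf ⊤ _ trivial _).trans ?_)
  exact congrArg _ h2

theorem topMap_finite : X.topMap.Finite := by
  have := X.proper
  have := X.isIntegral_C
  exact (finite_appTop_of_universallyClosed Fq X.str).comp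
    (RingHom.Finite.of_surjective _
      (Scheme.ΓSpecIso (CommRingCat.of Fq)).commRingCatIsoToRingEquiv.symm.surjective)

section FunctionField

variable [IsIntegral X.C] [Nonempty X.Caff]

instance : IsDomain X.A := inferInstanceAs (IsDomain Γ(X.C, X.Caff))

instance : Algebra X.A X.C.functionField :=
  inferInstanceAs (Algebra Γ(X.C, X.Caff) X.C.functionField)

theorem algebraMap_A_injective : Function.Injective (algebraMap X.A X.C.functionField) :=
  X.C.germToFunctionField_injective X.Caff

/-- An element integral over A lies in every local ring at a point of C ∖ {∞}, as these are
integrally closed, and is therefore a section there. -/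
theorem isIntegrallyClosed_A : IsIntegrallyClosed X.A := by
  refine .of_injective X.algebraMap_A_injective fun x hx => ?_
  refine exists_germToFunctionField_eq X.Caff x fun y hy => ?_
  obtain ⟨_, _, _⟩ := X.isFieldOrDVR_stalk y
  let y' : X.Caff := ⟨y, hy⟩
  let := TopCat.Presheaf.algebra_section_stalk X.C.presheaf y'
  have := functionField_isScalarTower X.C X.Caff y'
  have hx : IsIntegral Γ(X.C, X.Caff) x := hx
  exact IsIntegrallyClosed.isIntegral_iff.1 (hx.tower_top (A := X.C.presheaf.stalk y))

/-- A function on `C ∖ {∞}` that is regular at `∞` is a global function. -/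
theorem exists_top_of_regular (a : X.A) (ha : algebraMap X.A X.C.functionField a ∈
    Set.range (algebraMap (X.C.presheaf.stalk X.pt) X.C.functionField)) :
    ∃ t : Γ(X.C, ⊤), (X.C.presheaf.map (homOfLE le_top).op t : Γ(X.C, X.Caff)) = a := by
  have : Nonempty (⊤ : X.C.Opens) := ⟨⟨X.pt, trivial⟩⟩
  obtain ⟨t, ht⟩ := exists_germToFunctionField_eq (⊤ : X.C.Opens)
    (algebraMap X.A X.C.functionField a) (fun y _ => by
      rcases X.mem_Caff_or_eq_pt y with hy | rfl
      · exact ⟨X.C.presheaf.germ X.Caff y hy a,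
          Scheme.algebraMap_germ_eq_germToFunctionField X.C hy a⟩
      · exact ha)
  refine ⟨t, X.algebraMap_A_injective (Eq.trans ?_ ht)⟩
  exact X.C.presheaf.germ_res_apply (homOfLE le_top) (genericPoint X.C) _ t

instance : Algebra Fq (X.C.presheaf.stalk X.pt) := X.stalkMapInf.toAlgebra

instance : Algebra Fq X.C.functionField :=
  ((algebraMap X.A X.C.functionField).comp (algebraMap Fq X.A)).toAlgebra

instance : IsScalarTower Fq X.A X.C.functionField := .of_algebraMap_eq fun _ => rfl

instance : IsScalarTower Fq (X.C.presheaf.stalk X.pt) X.C.functionField :=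
  .of_algebraMap_eq fun l => by
    have : Nonempty (⊤ : X.C.Opens) := ⟨⟨X.pt, trivial⟩⟩
    refine Eq.trans ?_ (Scheme.algebraMap_germ_eq_germToFunctionField X.C (U := ⊤) (x := X.pt)
      trivial (X.topMap l)).symm
    exact X.C.presheaf.germ_res_apply (homOfLE le_top) (genericPoint X.C) _ (X.topMap l)

end FunctionField

/-- The ring `A` is a Dedekind domain of finite type over `Fq` that either contains a transcendental
element or equals `Fq`. -/
theorem structure_A [Nontrivial X.A] : IsDedekindDomain X.A ∧ Algebra.FiniteType Fq X.A ∧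
    ((∃ a : X.A, Transcendental Fq a) ∨ Function.Bijective (algebraMap Fq X.A)) := by
  have := X.isIntegral_C
  have := X.nonempty_Caff
  have := X.isIntegrallyClosed_A
  let T := Γ(X.C, ⊤)
  let : Algebra Fq T := X.topMap.toAlgebra
  have hT : Module.Finite Fq T := X.topMap_finite
  let ρ : T →ₐ[Fq] X.A :=
    { (X.C.presheaf.map (homOfLE le_top).op).hom with commutes' := fun _ => rfl }
  let G : Submodule Fq X.A := LinearMap.range ρ.toLinearMap
  have hG : G.FG := Module.Finite.iff_fg.1 inferInstance
  have hAO (a : X.A) (ha : algebraMap X.A X.C.functionField a ∈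
      Set.range (algebraMap (X.C.presheaf.stalk X.pt) X.C.functionField)) : a ∈ G :=
    X.exists_top_of_regular a ha
  by_cases h : ∃ a : X.A, algebraMap X.A X.C.functionField a ∉
      Set.range (algebraMap (X.C.presheaf.stalk X.pt) X.C.functionField)
  · obtain ⟨a, ha⟩ := h
    obtain ⟨htr, hfin⟩ := Polynomial.aeval_finite_of_isFieldOrDVR (k := Fq)
      (X.isFieldOrDVR_stalk X.pt) X.exists_sub_not_isUnit G hG hAO ha
    algebraize [(Polynomial.aeval (R := Fq) a).toRingHom]
    have : IsScalarTower Fq (Polynomial Fq) X.A := .of_algebraMap_eq fun x => by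
      simp [RingHom.algebraMap_toAlgebra]
    exact ⟨.of_moduleFinite (Polynomial Fq) X.A, .trans (S := Polynomial Fq) inferInstance inferInstance,
      Or.inl ⟨a, htr⟩⟩
  -- Every function is now regular at ∞, so A is a domain finite over F_q, hence a field. If a ≠ l
  -- with l the value of a at ∞, the inverse of a − l is also regular at ∞, so a − l is a unit
  -- there: a contradiction.
  · push Not at h
    have : Module.Finite Fq X.A := ⟨by
      rwa [← show G = ⊤ from eq_top_iff.2 fun a _ => hAO a (h a)]⟩
    refine ⟨.of_moduleFinite Fq X.A, inferInstance, Or.inr ⟨(algebraMap Fq X.A).injective, fun a => ?_⟩⟩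
    have hF : IsField X.A := isField_of_isIntegral_of_isField' (Field.toIsField Fq)
    obtain ⟨o, ho⟩ := h a
    obtain ⟨l, hl⟩ := X.exists_sub_not_isUnit o
    refine ⟨l, ?_⟩
    by_contra hne
    obtain ⟨b, hb⟩ := hF.mul_inv_cancel (sub_ne_zero.2 (Ne.symm hne))
    obtain ⟨p, hp⟩ := h b
    refine hl (IsUnit.of_mul_eq_one p (IsFractionRing.injective _ X.C.functionField ?_))
    rw [map_mul, map_sub, ho, hp, map_one, ← map_one (algebraMap X.A X.C.functionField), ← hb,
      map_mul, map_sub]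
    congr 2
    exact (IsScalarTower.algebraMap_apply Fq (X.C.presheaf.stalk X.pt) X.C.functionField l).symm

end PointedCurve

end

/-! ### Assembly -/

theorem mainTheorem3 {Fq : Type u} [Field Fq] [Finite Fq] (X : PointedCurve Fq)
    (L : Type u) [Field L] [Algebra Fq L] (c : X.A →ₐ[Fq] L) (r d r' d' : ℕ)
    (M : PureAndersonMotive X c r d) (M' : PureAndersonMotive X c r' d') :
    Module.Finite X.A (PureAndersonMotive.Hom M M') ∧
    Module.Projective X.A (PureAndersonMotive.Hom M M') ∧
    Module.rank X.A (PureAndersonMotive.Hom M M') ≤ ((r * r' : ℕ) : Cardinal) := by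
  -- The characteristic maps A to a field, which rules out an empty C ∖ {∞}.
  have : Nontrivial X.A := c.toRingHom.domain_nontrivial
  obtain ⟨_, _, h⟩ := X.structure_A
  have hc : PureAndersonMotive.TauCancel M M' := by
    rcases h with ⟨a, ha⟩ | h
    · exact PureAndersonMotive.tauCancel_of_transcendental a ha M M'
    · exact PureAndersonMotive.tauCancel_of_bijective h M M'
  have : IsNoetherianRing (X.AL L) := by
    have := Algebra.FiniteType.isNoetherianRing L (L ⊗[Fq] X.A)
    exact isNoetherianRing_of_ringEquiv _ (Algebra.TensorProduct.comm Fq L X.A).toRingEquiv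
  exact ⟨PureAndersonMotive.finite_hom hc, PureAndersonMotive.projective_hom hc,
    PureAndersonMotive.rank_hom_le hc⟩
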